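/- Let $R$ be an associative ring with identity and let $I$ be a two-sided ideal of $R$; all modules are unital left $R$-modules. A submodule $N$ of a module $M$ is *PSD in $M$* if for every submodule $X\le M$ with $N+X=M$ there is a projective direct summand $S$ of $M$ with $S\le N$ and $M=S\oplus X$. The module $M$ is *PSD for $I$* if every submodule of $IM$ is PSD in $M$, and $R$ is a *left PSD ring for $I$* if every finitely generated free left $R$-module is PSD for $I$. A module $P$ is *locally projective* if for every epimorphism $g:A\to B$, every homomorphism $f:P\to B$ and every finitely generated submodule $P_0\le P$ there is a homomorphism $h:P\to A$ with $f|_{P_0}=gh|_{P_0}$. A *locally projective $I$-cover* of a module $M$ is an epimorphism $f:P\to M$ with $P$ locally projective such that $\operatorname{Ker} f\le IP$ and $\operatorname{Ker} f$ is PSD in $P$. The ring $R$ is *$I$-semiperfect* if for every left ideal $K$ of $R$ there is a decomposition ${}_RR=A\oplus B$ into left ideals such that $A$ is projective, $A\subseteq K$ and $K\cap B\subseteq I$. **Theorem 3.10.** Consider the following conditions: 1. Every finitely generated $R$-module has a locally projective $I$-cover. 2. Every factor module of ${}_RR$ has a locally projective $I$-cover. 3. For every countably generated left ideal $K$ of $R$,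 $R/K$ has a locally projective $I$-cover. 4. $R$ is $I$-semiperfect. 5. Every simple $R$-module has a locally projective $I$-cover. 6. Every simple factor module of ${}_RR$ has a locally projective $I$-cover. Then $(1)\Rightarrow(2)\Rightarrow(3)\Rightarrow(4)$ and $(1)\Rightarrow(5)\Rightarrow(6)$; moreover $(4)\Rightarrow(1)$ if $R$ is a left PSD ring for $I$, and $(6)\Rightarrow(4)$ if $I$ is PSD in ${}_RR$. -/

import Mathlib

universe u v

/-- `P` is locally projective: every homomorphism `f : P → B` lifts through every epimorphism
`g : A → B` on each finitely generated submodule `P₀` of `P`. -/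
def IsLocallyProjective (R : Type u) [Ring R] (P : Type u) [AddCommGroup P] [Module R P] : Prop :=
  ∀ (A B : Type u) [AddCommGroup A] [AddCommGroup B] [Module R A] [Module R B]
    (g : A →ₗ[R] B) (f : P →ₗ[R] B), Function.Surjective g →
    ∀ P₀ : Submodule R P, P₀.FG → ∃ h : P →ₗ[R] A, ∀ x ∈ P₀, f x = g (h x)

/-- `N` is PSD in `M`: whenever `N + X = M`, there is a projective (direct summand) `S ≤ N` of `M`
with `M = S ⊕ X`. -/
def IsPSD {R : Type u} [Ring R] {M : Type v} [AddCommGroup M] [Module R M]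
    (N : Submodule R M) : Prop :=
  ∀ X : Submodule R M, N ⊔ X = ⊤ →
    ∃ S : Submodule R M, Module.Projective R S ∧ S ≤ N ∧ IsCompl S X

/-- `M` is PSD for `I`: every submodule of `I M` is PSD in `M`. -/
def IsPSDModuleFor {R : Type u} [Ring R] (I : Ideal R) (M : Type v) [AddCommGroup M]
    [Module R M] : Prop :=
  ∀ N : Submodule R M, N ≤ I • (⊤ : Submodule R M) → IsPSD N

/-- `R` is a left PSD ring for `I`: every finitely generated free left module is PSD for `I`. -/
def IsLeftPSDRingFor {R : Type u} [Ring R] (I : Ideal R) : Prop :=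
  ∀ (F : Type u) [AddCommGroup F] [Module R F], Module.Free R F → Module.Finite R F →
    IsPSDModuleFor I F

/-- `f : P → M` is a locally projective `I`-cover of `M`. -/
structure IsLocallyProjectiveCover {R : Type u} [Ring R] (I : Ideal R) {P : Type u} {M : Type v}
    [AddCommGroup P] [Module R P] [AddCommGroup M] [Module R M] (f : P →ₗ[R] M) : Prop where
  locallyProjective : IsLocallyProjective R P
  surjective : Function.Surjective f
  ker_le : LinearMap.ker f ≤ I • (⊤ : Submodule R P)
  ker_psd : IsPSD (LinearMap.ker f)

/-- `M` has a locally projective `I`-cover. -/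
def HasLocallyProjectiveCover {R : Type u} [Ring R] (I : Ideal R) (M : Type v)
    [AddCommGroup M] [Module R M] : Prop :=
  ∃ (P : Type u) (_ : AddCommGroup P) (_ : Module R P) (f : P →ₗ[R] M),
    IsLocallyProjectiveCover I f

/-- `M` is an `I`-semiperfect module: for every submodule `K` there is a decomposition
`M = A ⊕ B` with `A` projective, `A ≤ K` and `K ∩ B ≤ I M`. -/
def IsSemiperfectModuleFor {R : Type u} [Ring R] (I : Ideal R) (M : Type v) [AddCommGroup M]
    [Module R M] : Prop :=
  ∀ K : Submodule R M, ∃ A B : Submodule R M,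
    IsCompl A B ∧ Module.Projective R A ∧ A ≤ K ∧ K ⊓ B ≤ I • (⊤ : Submodule R M)

/-- `R` is an `I`-semiperfect ring: the left module `R` is `I`-semiperfect. -/
def IsSemiperfectRingFor {R : Type u} [Ring R] (I : Ideal R) : Prop :=
  IsSemiperfectModuleFor I R

/-- A left ideal is countably generated: it is spanned by a countable set. -/
def Ideal.IsCountablyGenerated {R : Type u} [Ring R] (K : Ideal R) : Prop :=
  ∃ s : Set R, s.Countable ∧ Ideal.span s = K

/-!
The argument replaces direct sum decompositions by idempotents. For a projective module `M`, being
`I`-semiperfect means that every submodule `K` admits an idempotent endomorphism `e` of `M` with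
image in `K` and `x - e x ∈ I M` for `x ∈ K` (`HasLiftingIdempotents`); for `M = R` this is an
idempotent `e ∈ K` with `K (1 - e) ⊆ I`.

* A locally projective `I`-cover `f : P → R ⧸ K` always yields such an `e ∈ K`
  (`HasLocallyProjectiveCover.exists_idempotent`). If `f x₀ = 1 + K`, the PSD condition on `ker f`
  makes `R x₀` a direct summand of `P`, and local projectivity lifts the projection onto `R x₀`
  through `R → R x₀` to a map `h : P → R`; then `e = 1 - h x₀`.
* If this is available for all countably generated `K`, then every left ideal agrees modulo `I`
  with a finitely generated left ideal contained in it: otherwise an ascending chain `N₀ ≤ N₁ ≤ …`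
  strict modulo `I` has a countably generated union, whose idempotent lies in some `Nₙ`, forcing
  `Nₙ₊₁ ≤ Nₙ + I`. The idempotent of the finitely generated ideal then serves the given one.
* If it is available for the maximal left ideals only, these are complemented modulo `I`, so
  `R ⧸ I` is semisimple; so it is Noetherian, and a left ideal `K` not contained in `I` is not
  contained in some maximal left ideal above `I`. When `I` is PSD in `R`, such a `K` has an
  idempotent outside `I` (`exists_idempotent_not_mem`), and an idempotent of `K`
  generating a maximal image in `R ⧸ I` is the one sought (`exists_idempotent_of_forall_not_le`).
* `HasLiftingIdempotents` passes to finite products of projective modules, hence to `Rⁿ`. For an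
  epimorphism `q : Rⁿ → M` and the idempotent `e` belonging to `ker q`, the restriction of `q` to
  `ker e` is a projective cover of the required kind, as soon as submodules of `I Rⁿ` are PSD
  (`HasLocallyProjectiveCover.of_surjective`).
-/

/-! ### Semiperfectness in terms of idempotent endomorphisms -/

/-- For every submodule `K` of `M` there is an idempotent endomorphism of `M` with values in `K`
which is the identity on `K` modulo `I M`. For projective `M` this is `I`-semiperfectness: the
decomposition of `M` consists of the range and the kernel of the endomorphism. -/
def HasLiftingIdempotents {R : Type u} [Ring R] (I : Ideal R) (M : Type v) [AddCommGroup M]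
    [Module R M] : Prop :=
  ∀ K : Submodule R M, ∃ e : Module.End R M, (∀ x, e (e x) = e x) ∧ (∀ x, e x ∈ K) ∧
    ∀ x ∈ K, x - e x ∈ I • (⊤ : Submodule R M)

section General

variable {R : Type u} [Ring R] {I : Ideal R}

theorem Submodule.map_mem_smul_top {M N : Type*} [AddCommGroup M] [Module R M] [AddCommGroup N]
    [Module R N] (f : M →ₗ[R] N) {x : M} (hx : x ∈ I • (⊤ : Submodule R M)) :
    f x ∈ I • (⊤ : Submodule R N) := by
  have h := Submodule.mem_map_of_mem (f := f) hx
  rw [Submodule.map_smul''] at h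
  exact Submodule.smul_mono le_rfl le_top h

theorem Ideal.IsTwoSided.smul_top_self [I.IsTwoSided] : I • (⊤ : Submodule R R) = I := by
  apply le_antisymm
  · exact Submodule.smul_le.2 fun r hr n _ => I.mul_mem_right n hr
  · intro r hr
    simpa using Submodule.smul_mem_smul hr (Submodule.mem_top (R := R) (x := (1 : R)))

theorem IsSemiperfectModuleFor.hasLiftingIdempotents {M : Type v} [AddCommGroup M] [Module R M]
    (h : IsSemiperfectModuleFor I M) : HasLiftingIdempotents I M := by
  intro K
  obtain ⟨A, B, hAB, -, hAK, hKB⟩ := h K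
  refine ⟨A.projection B hAB, fun x => ?_, fun x => hAK (by simp), fun x hx => hKB ⟨?_, ?_⟩⟩
  · exact Submodule.projection_apply_of_mem_left hAB (by simp)
  · exact sub_mem hx (hAK (by simp))
  · have hB : x - A.projection B hAB x ∈ LinearMap.ker (A.projection B hAB) := by
      rw [LinearMap.mem_ker, map_sub, sub_eq_zero]
      exact (Submodule.projection_apply_of_mem_left hAB (by simp)).symm
    rwa [Submodule.ker_projection] at hB

theorem Module.End.isCompl_range_ker_of_idempotent {M : Type*} [AddCommGroup M] [Module R M]
    {e : Module.End R M} (he : ∀ x, e (e x) = e x) :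
    IsCompl (LinearMap.range e) (LinearMap.ker e) :=
  LinearMap.IsIdempotentElem.isCompl (LinearMap.ext he)

theorem HasLiftingIdempotents.isSemiperfectModuleFor {M : Type v} [AddCommGroup M] [Module R M]
    [Module.Projective R M] (h : HasLiftingIdempotents I M) : IsSemiperfectModuleFor I M := by
  intro K
  obtain ⟨e, he, heK, hK⟩ := h K
  refine ⟨LinearMap.range e, LinearMap.ker e, Module.End.isCompl_range_ker_of_idempotent he,
    ?_, ?_, ?_⟩
  · refine Module.Projective.of_split (LinearMap.range e).subtype e.rangeRestrict ?_
    ext ⟨_, x, rfl⟩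
    exact he x
  · rintro _ ⟨x, rfl⟩
    exact heK x
  · rintro x ⟨hx, hx'⟩
    have := hK x hx
    rwa [LinearMap.mem_ker.1 hx', sub_zero] at this

theorem HasLiftingIdempotents.congr {M N : Type*} [AddCommGroup M] [Module R M] [AddCommGroup N]
    [Module R N] (φ : M ≃ₗ[R] N) (h : HasLiftingIdempotents I M) : HasLiftingIdempotents I N := by
  intro K
  obtain ⟨e, he, heK, hK⟩ := h (K.comap φ.toLinearMap)
  refine ⟨φ.toLinearMap ∘ₗ e ∘ₗ φ.symm.toLinearMap, fun x => ?_, fun x => heK _, fun x hx => ?_⟩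
  · simp [he]
  · simpa using Submodule.map_mem_smul_top φ.toLinearMap (hK (φ.symm x) (by simpa using hx))

/-- The idempotent which `N` provides for the image `p(K)`, composed with a lift of it to `K`, is an
idempotent endomorphism of `M`. -/
theorem HasLiftingIdempotents.exists_idempotent_end {M N : Type*} [AddCommGroup M] [Module R M]
    [AddCommGroup N] [Module R N] [Module.Projective R N] (h : HasLiftingIdempotents I N)
    (p : M →ₗ[R] N) (K : Submodule R M) :
    ∃ u : Module.End R M, (∀ x, u (u x) = u x) ∧ (∀ x, u x ∈ K) ∧
      ∀ x ∈ K, p (x - u x) ∈ I • (⊤ : Submodule R N) := by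
  obtain ⟨e, he, heK, hK⟩ := h (K.map p)
  obtain ⟨s, hs⟩ := Module.projective_lifting_property (p.submoduleMap K)
    (e.codRestrict _ heK) (p.submoduleMap_surjective K)
  have hs' (n : N) : p (s n) = e n := congr_arg Subtype.val (LinearMap.congr_fun hs n)
  refine ⟨K.subtype ∘ₗ s ∘ₗ e ∘ₗ p, fun x => ?_, fun x => (s _).2, fun x hx => ?_⟩
  · simp [hs', he]
  · simpa [hs', he] using hK (p x) (Submodule.mem_map_of_mem hx)

/-- The second component is treated first, by `u`; the first component is then treated on
`K ⊓ ker u`, by `v`. As `u ∘ v = 0`, the complement `(1 - v) (1 - u)` is idempotent. -/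
theorem HasLiftingIdempotents.prod {M N : Type*} [AddCommGroup M] [Module R M]
    [AddCommGroup N] [Module R N] [Module.Projective R M] [Module.Projective R N]
    (hM : HasLiftingIdempotents I M) (hN : HasLiftingIdempotents I N) :
    HasLiftingIdempotents I (M × N) := by
  intro K
  obtain ⟨u, hu, huK, huN⟩ := hN.exists_idempotent_end (LinearMap.snd R M N) K
  obtain ⟨v, hv, hvK, hvM⟩ := hM.exists_idempotent_end (LinearMap.fst R M N)
    (K ⊓ LinearMap.ker u)
  have huv (x) : u (v x) = 0 := (hvK x).2
  -- `1 - (1 - v) (1 - u)`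
  refine ⟨u + v ∘ₗ (LinearMap.id - u), fun x => ?_, fun x => ?_, fun x hx => ?_⟩
  · simp [hu, hv, huv]
  · exact add_mem (huK x) (hvK _).1
  · have hx1 : x - u x ∈ K ⊓ LinearMap.ker u := ⟨sub_mem hx (huK x), by simp [hu]⟩
    set w := x - u x - v (x - u x) with hw
    have hwK : w ∈ K ⊓ LinearMap.ker u := sub_mem hx1 (hvK _)
    have h1 : w.1 ∈ I • (⊤ : Submodule R M) := hvM _ hx1
    have h2 : w.2 ∈ I • (⊤ : Submodule R N) := by
      have := huN w hwK.1
      rwa [LinearMap.mem_ker.1 hwK.2, sub_zero] at this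
    have h3 := add_mem (Submodule.map_mem_smul_top (LinearMap.inl R M N) h1)
      (Submodule.map_mem_smul_top (LinearMap.inr R M N) h2)
    change x - (u x + v (x - u x)) ∈ _
    rw [← sub_sub, ← hw]
    simpa using h3

theorem HasLiftingIdempotents.fin_fun (h : HasLiftingIdempotents I R) (n : ℕ) :
    HasLiftingIdempotents I (Fin n → R) := by
  induction n with
  | zero => exact fun K => ⟨0, fun _ => rfl, fun _ => K.zero_mem, fun x _ => by
      rw [Subsingleton.elim (x - _) 0]
      exact zero_mem _⟩
  | succ n ih => exact (h.prod ih).congr (Fin.consLinearEquiv R fun _ : Fin (n + 1) => R)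

/-! ### Covers from decompositions and back -/

theorem Module.Projective.isLocallyProjective (P : Type u) [AddCommGroup P] [Module R P]
    [Module.Projective R P] : IsLocallyProjective R P := by
  intro A B _ _ _ _ g f hg P₀ _
  obtain ⟨h, hh⟩ := Module.projective_lifting_property g f hg
  exact ⟨h, fun x _ => (LinearMap.congr_fun hh x).symm⟩

/-- The cover is the restriction of `q` to the kernel of the idempotent belonging to `ker q`. -/
theorem HasLocallyProjectiveCover.of_surjective {F : Type u} {M : Type v} [AddCommGroup F]
    [Module R F] [AddCommGroup M] [Module R M] [Module.Projective R F]
    (hF : HasLiftingIdempotents I F) (hpsd : IsPSDModuleFor I F) (q : F →ₗ[R] M)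
    (hq : Function.Surjective q) : HasLocallyProjectiveCover I M := by
  obtain ⟨e, he, heK, hK⟩ := hF (LinearMap.ker q)
  have hc := Module.End.isCompl_range_ker_of_idempotent he
  set B := LinearMap.ker e
  have hr (x) : x - e x ∈ B := by simp [B, he]
  let ρ : F →ₗ[R] B := (LinearMap.id - e).codRestrict B hr
  have hρ (b : B) : ρ b = b := by
    ext
    simp [ρ, LinearMap.mem_ker.1 b.2]
  have : Module.Projective R B := .of_split B.subtype ρ (LinearMap.ext hρ)
  refine ⟨B, inferInstance, inferInstance, q ∘ₗ B.subtype,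
    Module.Projective.isLocallyProjective B, fun m => ?_, fun b hb => ?_, fun X hX => ?_⟩
  · obtain ⟨x, rfl⟩ := hq m
    refine ⟨⟨x - e x, hr x⟩, ?_⟩
    have : q (e x) = 0 := heK x
    simp [this]
  · have := hK b hb
    rw [LinearMap.mem_ker.1 b.2, sub_zero] at this
    simpa [hρ] using Submodule.map_mem_smul_top ρ this
  · have hle : LinearMap.ker q ⊓ B ≤ I • (⊤ : Submodule R F) := by
      rintro x ⟨hx, hxB⟩
      have := hK x hx
      rwa [LinearMap.mem_ker.1 hxB, sub_zero] at this
    obtain ⟨S, hS, hSK, hSX⟩ := hpsd _ hle (X.map B.subtype ⊔ LinearMap.range e) (by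
      have hX' := congr_arg (Submodule.map B.subtype) hX
      rw [Submodule.map_sup, Submodule.map_top, Submodule.range_subtype,
        LinearMap.ker_comp, Submodule.map_comap_subtype, inf_comm] at hX'
      rw [← sup_assoc, hX', sup_comm, hc.sup_eq_top])
    have hSB : S ≤ B := hSK.trans inf_le_right
    refine ⟨S.comap B.subtype, ?_, fun x hx => (hSK hx).1, ?_, ?_⟩
    · exact Module.Projective.of_equiv (Submodule.comapSubtypeEquivOfLe hSB).symm
    · rw [Submodule.disjoint_def]
      intro b hbS hbX
      exact Subtype.ext ((Submodule.disjoint_def.1 hSX.disjoint) b hbS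
        (Submodule.mem_sup_left (Submodule.mem_map_of_mem hbX)))
    · rw [codisjoint_iff, eq_top_iff]
      rintro b -
      have hb : (b : F) ∈ S ⊔ (X.map B.subtype ⊔ LinearMap.range e) := by
        rw [hSX.sup_eq_top]; trivial
      obtain ⟨s, hs, t, ht, hst⟩ := Submodule.mem_sup.1 hb
      obtain ⟨_, ⟨x, hx, rfl⟩, _, ⟨y, rfl⟩, rfl⟩ := Submodule.mem_sup.1 ht
      -- the component in `range e` vanishes because everything else lies in `ker e`
      have hy : e y = 0 := by
        have := congr_arg e hst
        rw [map_add, map_add, LinearMap.mem_ker.1 (hSB hs), LinearMap.mem_ker.1 b.2, he,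
          Submodule.subtype_apply, LinearMap.mem_ker.1 x.2] at this
        simpa using this
      rw [hy, add_zero] at hst
      exact Submodule.mem_sup.2 ⟨⟨s, hSB hs⟩, hs, x, hx, Subtype.ext hst⟩

theorem isSemiperfectRingFor_of_exists_idempotent [I.IsTwoSided]
    (h : ∀ K : Ideal R, ∃ e ∈ K, e * e = e ∧ ∀ x ∈ K, x - x * e ∈ I) :
    IsSemiperfectRingFor I := by
  refine HasLiftingIdempotents.isSemiperfectModuleFor fun K => ?_
  obtain ⟨e, heK, he, hK⟩ := h K
  refine ⟨LinearMap.toSpanSingleton R R e, fun x => ?_, fun x => ?_, fun x hx => ?_⟩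
  · simp [mul_assoc, he]
  · exact Ideal.mul_mem_left K x heK
  · rw [Ideal.IsTwoSided.smul_top_self]
    exact hK x hx

/-- For `f x₀ = 1 + K` and `h : P → R` lifting the projection onto `R x₀`, the element `c = h x₀`
satisfies `c x₀ = x₀`, so it is idempotent, `1 - c` annihilates `x₀` and hence lies in `K`, and
`x c = h (x x₀) ∈ h (I P) ⊆ I` for `x ∈ K`. -/
theorem HasLocallyProjectiveCover.exists_idempotent [I.IsTwoSided] {K : Ideal R}
    (h : HasLocallyProjectiveCover I (R ⧸ K)) :
    ∃ e ∈ K, e * e = e ∧ ∀ x ∈ K, x - x * e ∈ I := by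
  obtain ⟨P, _, _, f, hP, hf, hker, hpsd⟩ := h
  obtain ⟨x₀, hx₀⟩ := hf (Submodule.Quotient.mk 1)
  have hfr (r : R) : f (r • x₀) = Submodule.Quotient.mk r := by
    rw [map_smul, hx₀, ← Submodule.Quotient.mk_smul, smul_eq_mul, mul_one]
  obtain ⟨S, -, hSK, hS⟩ := hpsd (R ∙ x₀) (by
    rw [eq_top_iff]
    rintro y -
    obtain ⟨r, hr⟩ := Submodule.Quotient.mk_surjective K (f y)
    refine Submodule.mem_sup.2 ⟨y - r • x₀, ?_, r • x₀,
      Submodule.smul_mem _ _ (Submodule.mem_span_singleton_self x₀), by abel⟩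
    rw [LinearMap.mem_ker, map_sub, hfr, hr, sub_self])
  obtain ⟨h, hh⟩ := hP R (R ∙ x₀)
    ((LinearMap.toSpanSingleton R P x₀).codRestrict (R ∙ x₀)
      fun r => Submodule.smul_mem _ _ (Submodule.mem_span_singleton_self x₀))
    ((R ∙ x₀).projectionOnto S hS.symm) (by
      rintro ⟨y, hy⟩
      obtain ⟨r, rfl⟩ := Submodule.mem_span_singleton.1 hy
      exact ⟨r, rfl⟩)
    (R ∙ x₀) (Submodule.fg_span_singleton x₀)
  have hx : h x₀ • x₀ = x₀ := by
    have h1 := hh x₀ (Submodule.mem_span_singleton_self x₀)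
    rw [Submodule.projectionOnto_apply_of_mem_left hS.symm
      (Submodule.mem_span_singleton_self x₀)] at h1
    exact (congr_arg Subtype.val h1).symm
  have hidem : h x₀ * h x₀ = h x₀ := by
    rw [← smul_eq_mul, ← map_smul, hx]
  refine ⟨1 - h x₀, ?_, by simp [mul_sub, sub_mul, hidem], fun x hxK => ?_⟩
  · rw [← Submodule.Quotient.mk_eq_zero, ← hfr, sub_smul, one_smul, hx, sub_self, map_zero]
  · have h1 : x • x₀ ∈ LinearMap.ker f := by
      rw [LinearMap.mem_ker, hfr, Submodule.Quotient.mk_eq_zero]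
      exact hxK
    have h2 := Submodule.map_mem_smul_top h (hker h1)
    rw [Ideal.IsTwoSided.smul_top_self, map_smul, smul_eq_mul] at h2
    simpa [mul_sub] using h2

/-! ### Countably generated left ideals -/

/-- Every left ideal agrees modulo `I` with a finitely generated left ideal contained in it. -/
theorem exists_fg_le_sup
    (h : ∀ K : Ideal R, K.IsCountablyGenerated → ∃ e ∈ K, ∀ x ∈ K, x - x * e ∈ I)
    (K : Ideal R) : ∃ N : Ideal R, N.FG ∧ N ≤ K ∧ K ≤ N ⊔ I := by
  by_contra! hK
  obtain ⟨N, hN, hlt⟩ := exists_seq_of_forall_finset_exists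
    (fun N : Ideal R => N.FG ∧ N ≤ K) (fun N N' => N ≤ N' ∧ ¬ N' ≤ N ⊔ I) (by
      intro s hs
      have hfg : (s.sup id).FG := Submodule.fg_finset_sup s id fun N hN => (hs N hN).1
      have hle : s.sup id ≤ K := Finset.sup_le fun N hN => (hs N hN).2
      obtain ⟨x, hxK, hx⟩ := SetLike.not_le_iff_exists.1 (hK _ hfg hle)
      refine ⟨s.sup id ⊔ Ideal.span {x}, ⟨Submodule.FG.sup hfg (Submodule.fg_span_singleton x),
        sup_le hle ((Ideal.span_singleton_le_iff_mem K).2 hxK)⟩, fun N hN => ⟨?_, fun hc => hx ?_⟩⟩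
      · exact (Finset.le_sup (f := id) hN).trans le_sup_left
      · exact sup_le_sup_right (Finset.le_sup (f := id) hN) I
          (hc (Ideal.mem_sup_right (Ideal.mem_span_singleton_self x))))
  have hmono : Monotone N := monotone_nat_of_le_succ fun n => (hlt n (n + 1) n.lt_succ_self).1
  obtain ⟨e, he, hL⟩ := h (⨆ n, N n) (by
    choose s hs using fun n => (hN n).1
    refine ⟨⋃ n, (s n : Set R), Set.countable_iUnion fun n => (s n).countable_toSet, ?_⟩
    rw [Ideal.span, Submodule.span_iUnion]
    exact iSup_congr hs)
  obtain ⟨n, hn⟩ := (Submodule.mem_iSup_of_directed N hmono.directed_le).1 he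
  refine (hlt n (n + 1) n.lt_succ_self).2 fun x hx => ?_
  rw [← add_sub_cancel (x * e) x]
  exact add_mem (Ideal.mem_sup_left (Ideal.mul_mem_left _ x hn))
    (Ideal.mem_sup_right (hL x (Submodule.mem_iSup_of_mem (n + 1) hx)))

theorem isSemiperfectRingFor_of_isCountablyGenerated [I.IsTwoSided]
    (h : ∀ K : Ideal R, K.IsCountablyGenerated →
      ∃ e ∈ K, e * e = e ∧ ∀ x ∈ K, x - x * e ∈ I) : IsSemiperfectRingFor I := by
  refine isSemiperfectRingFor_of_exists_idempotent fun K => ?_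
  obtain ⟨N, ⟨s, hs⟩, hNK, hKN⟩ := exists_fg_le_sup
    (fun K hK => (h K hK).imp fun e he => ⟨he.1, he.2.2⟩) K
  obtain ⟨e, heN, he, hN⟩ := h N ⟨s, s.countable_toSet, hs⟩
  refine ⟨e, hNK heN, he, fun x hx => ?_⟩
  obtain ⟨y, hy, i, hi, rfl⟩ := Submodule.mem_sup.1 (hKN hx)
  rw [add_mul, add_sub_add_comm]
  exact add_mem (hN y hy) (sub_mem hi (I.mul_mem_right e hi))

/-! ### Maximal left ideals -/

/-- Otherwise the socle lies in a maximal submodule, whose complement is simple and thus lies in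
the socle. -/
theorem IsSemisimpleModule.of_isCoatom_isComplemented {M : Type*} [AddCommGroup M] [Module R M]
    [Module.Finite R M] (h : ∀ N : Submodule R M, IsCoatom N → IsComplemented N) :
    IsSemisimpleModule R M := by
  apply IsSemisimpleModule.of_sSup_simples_eq_top
  by_contra hne
  obtain ⟨N, hN, hle⟩ := (eq_top_or_exists_le_coatom _).resolve_left hne
  obtain ⟨C, hC⟩ := h N hN
  have hCa : IsAtom C := hC.symm.isAtom_iff_isCoatom.2 hN
  have hCN : C ≤ N := le_trans (le_sSup (by simpa [isSimpleModule_iff_isAtom] using hCa)) hle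
  exact hCa.1 (hC.symm.disjoint.eq_bot_of_le hCN)

theorem isSemisimpleModule_quotient
    (h : ∀ M : Ideal R, M.IsMaximal → ∃ e ∈ M, ∀ x ∈ M, x - x * e ∈ I) :
    IsSemisimpleModule R (R ⧸ I) := by
  refine IsSemisimpleModule.of_isCoatom_isComplemented fun N hN => ?_
  have hM : Ideal.IsMaximal (N.comap I.mkQ) :=
    ⟨(Submodule.isCoatom_comap_iff I.mkQ_surjective).2 hN⟩
  obtain ⟨e, he, hMe⟩ := h _ hM
  refine ⟨Submodule.map I.mkQ (Ideal.span {1 - e}), ?_, ?_⟩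
  · rw [Submodule.disjoint_def]
    rintro _ hxN ⟨y, hy, rfl⟩
    obtain ⟨r, rfl⟩ := Ideal.mem_span_singleton'.1 hy
    have hr : r ∈ N.comap I.mkQ := by
      have h1 : r * e ∈ N.comap I.mkQ := Ideal.mul_mem_left _ r he
      have h2 : r * (1 - e) ∈ N.comap I.mkQ := hxN
      have := add_mem h1 h2
      rwa [← mul_add, add_sub_cancel, mul_one] at this
    rw [Submodule.mkQ_apply, Submodule.Quotient.mk_eq_zero, mul_sub, mul_one]
    exact hMe r hr
  · rw [codisjoint_iff, eq_top_iff]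
    rintro x -
    obtain ⟨r, rfl⟩ := I.mkQ_surjective x
    refine Submodule.mem_sup.2 ⟨I.mkQ (r * e), Ideal.mul_mem_left (N.comap I.mkQ) r he,
      I.mkQ (r * (1 - e)), Submodule.mem_map_of_mem
        (Ideal.mul_mem_left _ r (Ideal.mem_span_singleton_self _)), ?_⟩
    rw [← map_add, ← mul_add, add_sub_cancel, mul_one]

theorem exists_isMaximal_not_le [IsSemisimpleModule R (R ⧸ I)] {K : Ideal R} (hK : ¬ K ≤ I) :
    ∃ M : Ideal R, M.IsMaximal ∧ I ≤ M ∧ ¬ K ≤ M := by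
  obtain ⟨x, hxK, hx⟩ := SetLike.not_le_iff_exists.1 hK
  have hx' : I.mkQ x ∉ Module.jacobson R (R ⧸ I) := by
    rw [IsSemisimpleModule.jacobson_eq_bot R (R ⧸ I), Submodule.mem_bot, Submodule.mkQ_apply,
      Submodule.Quotient.mk_eq_zero]
    exact hx
  rw [Module.jacobson, Submodule.mem_sInf] at hx'
  push Not at hx'
  obtain ⟨N, hN, hxN⟩ := hx'
  refine ⟨N.comap I.mkQ, ⟨(Submodule.isCoatom_comap_iff I.mkQ_surjective).2 hN⟩,
    fun y hy => ?_, fun hle => hxN (hle hxK)⟩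
  rw [Submodule.mem_comap, Submodule.mkQ_apply, (Submodule.Quotient.mk_eq_zero I).2 hy]
  exact N.zero_mem

/-- If `w ∈ R c` is congruent modulo `I` to the idempotent `c`, then `w` is von Neumann regular: the
PSD condition splits `R (1 - c) + R w` off `R`. -/
theorem IsPSD.exists_regular (hI : IsPSD (M := R) I) {c w : R} (hc : c * c = c)
    (hwc : w * c = w) (hcw : c - w ∈ I) : ∃ z, w * z * w = w := by
  have hwX : w ∈ Ideal.span {1 - c, w} := Ideal.subset_span (by simp)
  have htop : I ⊔ Ideal.span {1 - c, w} = ⊤ := by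
    rw [Ideal.eq_top_iff_one]
    refine Submodule.mem_sup.2 ⟨c - w, hcw, (1 - c) + w,
      add_mem (Ideal.subset_span (by simp)) hwX, by abel⟩
  obtain ⟨S, -, -, hS⟩ := hI _ htop
  -- the projection of `1` onto the complement of `S` is a right unit on that complement
  set p := (Ideal.span {1 - c, w}).projection S hS.symm with hp
  have hp1 : p 1 ∈ Ideal.span {1 - c, w} := by simp [hp]
  have hw : w * p 1 = w := by
    rw [← smul_eq_mul, ← map_smul, smul_eq_mul, mul_one]
    exact Submodule.projection_apply_of_mem_left hS.symm hwX
  obtain ⟨r, z, hrz⟩ := Ideal.mem_span_pair.1 hp1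
  refine ⟨z, ?_⟩
  calc w * z * w = w * (r * (1 - c) + z * w) * c := by
        simp only [mul_add, add_mul, mul_assoc, hwc, sub_mul, one_mul, hc, sub_self, mul_zero,
          zero_add]
    _ = w := by rw [hrz, hw, hwc]

/-- With `c = 1 - e`, the ideal `M` satisfies `M c ⊆ I`. Since `1 = k + m` with `k ∈ K` and `m ∈ M`,
the element `w = k c` is congruent to `c` modulo `I`, so `w = w z w` for some `z`, and
`c z w z k ∈ K` is an idempotent. It is not in `I`, as `k (c z w z k) c = w`. -/
theorem exists_idempotent_not_mem [I.IsTwoSided] (hI : IsPSD (M := R) I) {K M : Ideal R}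
    (hM : M.IsMaximal) (hIM : I ≤ M) (hKM : ¬ K ≤ M)
    (hcov : ∃ e ∈ M, e * e = e ∧ ∀ x ∈ M, x - x * e ∈ I) :
    ∃ g ∈ K, g * g = g ∧ g ∉ I := by
  obtain ⟨e, heM, he, hMe⟩ := hcov
  set c := 1 - e with hcdef
  have hc : c * c = c := by simp [hcdef, mul_sub, sub_mul, he]
  have hMc : ∀ x ∈ M, x * c ∈ I := fun x hx => by simpa [hcdef, mul_sub] using hMe x hx
  have hcM : c ∉ M := fun h => hM.ne_top
    ((Ideal.eq_top_iff_one M).2 (by simpa [hcdef] using add_mem h heM))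
  have hKM' : K ⊔ M = ⊤ := by
    rw [sup_comm]
    exact hM.1.2 _ (left_lt_sup.2 hKM)
  obtain ⟨k, hk, m, hm, hkm⟩ := Submodule.mem_sup.1 ((Ideal.eq_top_iff_one _).1 hKM')
  have hcw : c - k * c ∈ I := by
    have : c - k * c = m * c := by
      rw [sub_eq_iff_eq_add', ← add_mul, hkm, one_mul]
    rw [this]
    exact hMc m hm
  obtain ⟨z, hz⟩ := hI.exists_regular hc (by rw [mul_assoc, hc]) hcw
  set w := k * c with hw
  have hz' (t) : w * (z * (w * t)) = w * t := by rw [← mul_assoc, ← mul_assoc, hz]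
  have hkc (t) : k * (c * t) = w * t := by rw [hw, mul_assoc]
  refine ⟨c * (z * w * z) * k, Ideal.mul_mem_left _ _ hk, ?_, fun hmem => hcM (hIM ?_)⟩
  · simp only [mul_assoc, hkc, hz']
  · have h1 : k * (c * (z * w * z) * k) * c ∈ I :=
      I.mul_mem_right c (I.mul_mem_left k hmem)
    have h2 : k * (c * (z * w * z) * k) * c = w := by
      simp only [mul_assoc, hkc, hz']
      rw [← hw, ← mul_assoc, hz]
    rw [h2] at h1
    simpa using add_mem hcw h1

/-- If `e ∈ K` is idempotent and `g ∈ K` is an idempotent outside `I` with `g e = 0`, then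
`e + g - e g` is an idempotent of `K` which generates a larger left ideal modulo `I`. -/
theorem exists_idempotent_of_forall_not_le [I.IsTwoSided] [IsNoetherian R (R ⧸ I)]
    (h : ∀ K : Ideal R, ¬ K ≤ I → ∃ g ∈ K, g * g = g ∧ g ∉ I) (K : Ideal R) :
    ∃ e ∈ K, e * e = e ∧ ∀ x ∈ K, x - x * e ∈ I := by
  let φ : R → Submodule R (R ⧸ I) := fun e => Submodule.map I.mkQ (Ideal.span {e})
  have hφ {a b : R} : φ a ≤ φ b ↔ ∃ r, a - r * b ∈ I := by
    rw [Submodule.map_le_iff_le_comap, Ideal.span, Submodule.span_le, Set.singleton_subset_iff]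
    constructor
    · rintro ⟨y, hy, hya⟩
      obtain ⟨r, rfl⟩ := Ideal.mem_span_singleton'.1 hy
      exact ⟨r, (Submodule.Quotient.eq I).1 hya.symm⟩
    · rintro ⟨r, hr⟩
      exact ⟨r * b, Ideal.mul_mem_left _ r (Ideal.mem_span_singleton_self b),
        ((Submodule.Quotient.eq I).2 hr).symm⟩
  -- an idempotent of `K` whose image in `R ⧸ I` generates as large an ideal as possible
  obtain ⟨e, ⟨heK, he⟩, hmax⟩ := (InvImage.wf φ
    (wellFounded_gt (α := Submodule R (R ⧸ I)))).has_min {e | e ∈ K ∧ e * e = e}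
    ⟨0, K.zero_mem, mul_zero 0⟩
  refine ⟨e, heK, he, ?_⟩
  by_contra! hbad
  obtain ⟨x, hxK, hx⟩ := hbad
  -- an idempotent outside `I` in the left ideal `{y ∈ K | y e = 0}`, which contains `x - x e`
  obtain ⟨g, ⟨hgK, hge⟩, hg, hgI⟩ := h (K ⊓ LinearMap.ker (LinearMap.toSpanSingleton R R e))
    fun hle => hx (hle ⟨sub_mem hxK (Ideal.mul_mem_left K x heK), by simp [sub_mul, mul_assoc, he]⟩)
  replace hge : g * e = 0 := hge
  have hge' (t) : g * (e * t) = 0 := by rw [← mul_assoc, hge, zero_mul]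
  have he' (t) : e * (e * t) = e * t := by rw [← mul_assoc, he]
  refine hmax (e + g - e * g) ⟨sub_mem (add_mem heK hgK) (Ideal.mul_mem_left K e hgK), ?_⟩
    (lt_of_le_not_ge (hφ.2 ⟨e, ?_⟩) fun hle => hgI ?_)
  · simp only [mul_add, add_mul, mul_sub, sub_mul, mul_assoc, he, hg, hge, hge', he', mul_zero]
    abel
  · have : e * (e + g - e * g) = e := by
      simp only [mul_add, mul_sub, he, he']
      abel
    rw [this, sub_self]
    exact I.zero_mem
  · obtain ⟨r, hr⟩ := hφ.1 hle
    have h1 := I.mul_mem_right (1 - e) (I.mul_mem_left g hr)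
    have h2 : g * (e + g - e * g - r * e) * (1 - e) = g := by
      simp only [mul_add, mul_sub, sub_mul, mul_assoc, mul_one, he, hg, hge, hge', zero_add,
        sub_zero]
      abel
    rwa [h2] at h1

theorem isSemiperfectRingFor_of_isPSD [I.IsTwoSided] (hI : IsPSD (M := R) I)
    (h : ∀ M : Ideal R, M.IsMaximal → ∃ e ∈ M, e * e = e ∧ ∀ x ∈ M, x - x * e ∈ I) :
    IsSemiperfectRingFor I := by
  have : IsSemisimpleModule R (R ⧸ I) := isSemisimpleModule_quotient
    fun M hM => (h M hM).imp fun e he => ⟨he.1, he.2.2⟩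
  refine isSemiperfectRingFor_of_exists_idempotent <| exists_idempotent_of_forall_not_le
    fun K hK => ?_
  obtain ⟨M, hM, hIM, hKM⟩ := exists_isMaximal_not_le hK
  exact exists_idempotent_not_mem hI hM hIM hKM (h M hM)

end General

theorem theorem3p10 {R : Type u} [Ring R] (I : Ideal R) [I.IsTwoSided] :
    -- (1) implies (2)
    ((∀ (M : Type u) [AddCommGroup M] [Module R M], Module.Finite R M →
        HasLocallyProjectiveCover I M) →
      ∀ K : Ideal R, HasLocallyProjectiveCover I (R ⧸ K)) ∧
    -- (2) implies (3)
    ((∀ K : Ideal R, HasLocallyProjectiveCover I (R ⧸ K)) →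
      ∀ K : Ideal R, K.IsCountablyGenerated → HasLocallyProjectiveCover I (R ⧸ K)) ∧
    -- (3) implies (4)
    ((∀ K : Ideal R, K.IsCountablyGenerated → HasLocallyProjectiveCover I (R ⧸ K)) →
      IsSemiperfectRingFor I) ∧
    -- (1) implies (5)
    ((∀ (M : Type u) [AddCommGroup M] [Module R M], Module.Finite R M →
        HasLocallyProjectiveCover I M) →
      ∀ (M : Type u) [AddCommGroup M] [Module R M], IsSimpleModule R M →
        HasLocallyProjectiveCover I M) ∧
    -- (5) implies (6)
    ((∀ (M : Type u) [AddCommGroup M] [Module R M], IsSimpleModule R M →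
        HasLocallyProjectiveCover I M) →
      ∀ K : Ideal R, IsSimpleModule R (R ⧸ K) → HasLocallyProjectiveCover I (R ⧸ K)) ∧
    -- (4) implies (1) if R is a left PSD ring for I
    (IsLeftPSDRingFor I → IsSemiperfectRingFor I →
      ∀ (M : Type u) [AddCommGroup M] [Module R M], Module.Finite R M →
        HasLocallyProjectiveCover I M) ∧
    -- (6) implies (4) if I is PSD in R as a left module
    (IsPSD (M := R) I →
      (∀ K : Ideal R, IsSimpleModule R (R ⧸ K) → HasLocallyProjectiveCover I (R ⧸ K)) →
      IsSemiperfectRingFor I) := by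
  refine ⟨fun h K => h _ inferInstance, fun h K _ => h K, fun h => ?_, fun h M _ _ _ => ?_,
    fun h K hK => h _ hK, fun hpsd h M _ _ hM => ?_, fun hI h => ?_⟩
  · exact isSemiperfectRingFor_of_isCountablyGenerated fun K hK => (h K hK).exists_idempotent
  · exact h M inferInstance
  · obtain ⟨n, q, hq⟩ := Module.Finite.exists_fin' R M
    exact HasLocallyProjectiveCover.of_surjective
      (HasLiftingIdempotents.fin_fun (IsSemiperfectModuleFor.hasLiftingIdempotents h) n)
      (hpsd (Fin n → R) inferInstance inferInstance) q hq
  · exact isSemiperfectRingFor_of_isPSD hI fun M hM =>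
      (h M (isSimpleModule_iff_isCoatom.2 hM.out)).exists_idempotent
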